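/- Let $p$ be a prime number and let $\Pi$ be a profinite group. All homomorphisms and actions below are continuous, and $H^q$ denotes continuous cohomology. An embedding problem for $\Pi$ is a pair of epimorphisms of profinite groups $\alpha\colon \Pi\to G$, $f\colon \Gamma\to G$. It is a finite $p$-embedding problem if $\Gamma$ is finite and $\ker f$ is a $p$-group. A proper solution is a surjective homomorphism $\beta\colon \Pi\to\Gamma$ with $f\circ\beta=\alpha$, and the problem is properly solvable if it has a proper solution. The cohomological $p$-dimension ${\rm cd}_p(\Pi)\in\mathbb{N}\cup\{\infty\}$ is the least $n$ such that for every integer $q>n$ and every discrete torsion $\Pi$-module $A$ the $p$-primary component of $H^q(\Pi,A)$ is zero. The group $\Pi$ is strongly $p$-dominating if $H^1(\Pi,P)$ is infinite for every nontrivial finite elementary abelian $p$-group $P$ on which $\Pi$ acts. Theorem. Every finite $p$-embedding problem for $\Pi$ is properly solvable if and only if ${\rm cd}_p(\Pi)\le 1$ and $\Pi$ is strongly $p$-dominating. -/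

import Mathlib

universe u

/-- An embedding problem for a topological group `G`: profinite groups `B` and `A` together with
continuous epimorphisms `α : G → A` and `f : B → A`. -/
structure EmbeddingProblem (G : Type u) [Group G] [TopologicalSpace G] where
  /-- The group to be mapped onto. -/
  B : ProfiniteGrp.{u}
  /-- The common target. -/
  A : ProfiniteGrp.{u}
  /-- The epimorphism from the given group. -/
  α : G →ₜ* A
  /-- The epimorphism whose kernel is the kernel of the embedding problem. -/
  f : B →ₜ* A
  α_surjective : Function.Surjective α
  f_surjective : Function.Surjective f

namespace EmbeddingProblem

variable {G : Type u} [Group G] [TopologicalSpace G]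

/-- The kernel of an embedding problem. -/
def kernel (E : EmbeddingProblem G) : Subgroup E.B := E.f.toMonoidHom.ker

/-- The embedding problem is finite if the group `B` is finite. -/
def IsFinite (E : EmbeddingProblem G) : Prop := Finite E.B

/-- The embedding problem is a `p`-embedding problem if its kernel is a `p`-group. -/
def IsPProblem (E : EmbeddingProblem G) (p : ℕ) : Prop := IsPGroup p E.kernel

/-- A weak solution: a continuous homomorphism `β : G → B` with `f ∘ β = α`. -/
def IsWeakSolution (E : EmbeddingProblem G) (β : G →ₜ* E.B) : Prop := E.f.comp β = E.α

/-- A proper solution: a surjective weak solution. -/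
def IsProperSolution (E : EmbeddingProblem G) (β : G →ₜ* E.B) : Prop :=
  E.IsWeakSolution β ∧ Function.Surjective β

/-- The embedding problem has a proper solution. -/
def ProperlySolvable (E : EmbeddingProblem G) : Prop :=
  ∃ β : G →ₜ* E.B, E.IsProperSolution β

end EmbeddingProblem

section Cohomology

variable {G : Type u} [Group G] [TopologicalSpace G] [IsTopologicalGroup G]

/-- A discrete `G`-module: an abelian group with the discrete topology on which `G` acts by
automorphisms such that the action map `G × A → A` is continuous. (An object of `TopRep ℤ G` only
carries the continuity of each single `g : A → A`.) -/
structure IsDiscreteGModule (A : TopRep.{u} ℤ G) : Prop where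
  discreteTopology : DiscreteTopology A
  continuous_action : Continuous fun x : G × A => A.ρ x.1 x.2

variable (G)

/-- The cohomological `p`-dimension `cd_p(G)`: the least `n` such that for all `q > n` and all
discrete torsion `G`-modules `A` the `p`-primary component of `H^q(G, A)` vanishes, and `⊤` if
there is no such natural number. -/
noncomputable def cohomologicalPDimension (p : ℕ) : ℕ∞ :=
  sInf {n : ℕ∞ | ∀ q : ℕ, n < (q : ℕ∞) → ∀ A : TopRep.{u} ℤ G, IsDiscreteGModule A →
    IsAddTorsion A →
      ∀ x : continuousCohomology q A, (∃ k : ℕ, p ^ k • x = 0) → x = 0}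

/-- `G` is strongly `p`-dominating: `H^1(G, P)` is infinite for every nontrivial finite elementary
abelian `p`-group `P` on which `G` acts continuously. -/
def IsStronglyPDominating (p : ℕ) : Prop :=
  ∀ P : TopRep.{u} ℤ G, IsDiscreteGModule P → Finite P → Nontrivial P →
    (∀ x : P, p • x = 0) → Infinite (continuousCohomology 1 P)

end Cohomology

/-!
# Proper solvability of finite `p`-embedding problems

Both conditions of the theorem are read off from inhomogeneous cochains in degrees one and two.

*Cochains.* The modules `X n` of the standard resolution of `A` satisfy `X (n + 1) = C(G, X n)`, and
`f ↦ f 1` contracts the resolution. Hence every class in `H^(n+1)(G, A)` is the class of `d h` for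
some `h ∈ X (n + 1)` with `d h` invariant, and it vanishes iff `d h = d y` with `y` invariant
(`TopRep.exists_presentation`). For `n = 0` this gives the crossed homomorphisms
(`TopRep.exists_oneCocycle_presentation`), for `n = 1` the inhomogeneous `2`-cocycles
(`TopRep.exists_twoCochain_of_eq_zero`). In degree `n + 2`, the failure of `h` to be invariant
lifts to a map `e : G → X (n + 1)` whose coboundary is a `2`-cocycle with values in a *finite*
submodule of the kernel of `d`. If `2`-cocycles with values in finite `p`-primary modules are
coboundaries, then a multiple of `e` by an integer prime to `p` can be corrected to a crossed
homomorphism into `X (n + 1) = C(G, X n)`, and these are all principal. So a single statement about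
finite modules (`TwoCocyclesSplit`) controls the `p`-primary part of every `H^q` with `q ≥ 2`
(`TwoCocyclesSplit.eq_zero_of_pow_smul_eq_zero`).

*Solvability implies the cohomological conditions.* A `2`-cocycle `z` with values in a finite
`p`-primary module `M` is inflated from a finite quotient `G ⧸ U` that acts on `M`, and a proper
solution for the extension of `G ⧸ U` by `M` defined by `z` is a cochain with coboundary `z` that
maps the kernel of the action onto `M` (`exists_cochain_of_properlySolvable`). Hence `cd_p ≤ 1`.
For `M = P ^ n` and `z = 0` the components of this cochain are crossed homomorphisms with pairwise
distinct classes, since a principal one vanishes on the kernel of the action; so `H^1(G, P)` has at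
least `n` elements for every `n`.

*The cohomological conditions imply solvability.* By induction on the order of `Γ` it suffices to
lift a surjection `G → Γ ⧸ N` to `Γ`, where `N` is a minimal normal subgroup of `Γ` inside the
kernel; `N` is elementary abelian. As `H^2(G, N)` has no `p`-torsion, there is a homomorphic lift,
and multiplying it by crossed homomorphisms gives infinitely many others, because `H^1(G, N)` is
infinite. The image of a lift that is not surjective is a complement of `N`, and it determines the
lift; the finite group `Γ` has only finitely many subgroups, so some lift is surjective
(`exists_surjective_lift_of_minimal_normal`).
-/

open CategoryTheory TopRep ContRepresentation

/-! ### Classes in continuous cohomology -/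

section Cohomology

variable {k : Type*} [Ring k] [TopologicalSpace k]

/-- Homology of topological modules is, as an abstract group, kernel modulo image. -/
theorem TopModuleCat.exists_homology_presentation (S : ShortComplex (TopModuleCat k)) :
    ∃ Φ : S.g.hom.ker →+ S.homology, Function.Surjective Φ ∧
      ∀ z, Φ z = 0 ↔ ∃ y, S.f.hom y = z.1 := by
  let D : S.LeftHomologyData := ⟨_, _, _, _, _, isLimitKer _, by simp, isColimitCoker _⟩
  have hf : ∀ y, (D.f'.hom y : S.g.hom.ker).1 = S.f.hom y := by
    intro y
    have := ConcreteCategory.congr_hom D.f'_i y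
    rw [ConcreteCategory.comp_apply] at this
    exact this
  have hinj : Function.Injective D.homologyIso.inv.hom := fun a b h => by
    have := congrArg D.homologyIso.hom.hom h
    rwa [← ConcreteCategory.comp_apply, ← ConcreteCategory.comp_apply,
      D.homologyIso.inv_hom_id] at this
  have hsurj : Function.Surjective D.homologyIso.inv.hom := fun a =>
    ⟨D.homologyIso.hom.hom a, by
      rw [← ConcreteCategory.comp_apply, D.homologyIso.hom_inv_id]; rfl⟩
  refine ⟨AddMonoidHom.comp (D.homologyIso.inv.hom : D.H →+ S.homology) (D.π.hom : D.K →+ D.H),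
    hsurj.comp (cokerπ_surjective _), fun z => ?_⟩
  refine (map_eq_zero_iff D.homologyIso.inv.hom hinj).trans ?_
  refine (Submodule.Quotient.mk_eq_zero D.f'.hom.range).trans ?_
  refine ⟨fun ⟨y, hy⟩ => ⟨y, (hf y).symm.trans (congrArg Subtype.val hy)⟩,
    fun ⟨y, hy⟩ => ⟨y, Subtype.ext ((hf y).trans hy)⟩⟩

variable {G : Type*} [Group G] [TopologicalSpace G] [IsTopologicalGroup G]

lemma TopRep.d_succ_apply (A : TopRep k G) (n : ℕ) (f : C(G, resolutionX A n)) (x : G) :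
    ((d A (n + 1)).hom f : C(G, resolutionX A (n + 1))) x = f - (d A n).hom (f x) := rfl

lemma TopRep.d_d (A : TopRep k G) (n : ℕ) (f : resolutionX A n) :
    (d A (n + 1)).hom ((d A n).hom f) = 0 :=
  ConcreteCategory.congr_hom (d_comp_d A n) f

/-- Evaluation at `1` is a contracting homotopy of the standard resolution. -/
lemma TopRep.d_eval_one (A : TopRep k G) (n : ℕ) (f : C(G, resolutionX A n))
    (hf : (d A (n + 1)).hom f = 0) : (d A n).hom (f 1) = f := by
  have h : ((d A (n + 1)).hom f : C(G, resolutionX A (n + 1))) 1 = 0 := by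
    rw [hf]; rfl
  rw [d_succ_apply, sub_eq_zero] at h
  exact h.symm

lemma TopRep.d_smul (A : TopRep k G) (n : ℕ) (g : G) (f : resolutionX A n) :
    (d A n).hom ((resolutionX A n).ρ g f) = (resolutionX A (n + 1)).ρ g ((d A n).hom f) :=
  (d A n).hom.isIntertwining g f

/-- The elements of the standard resolution whose differential is `G`-invariant. These differentials
are exactly the homogeneous cocycles, because the resolution is exact. -/
def TopRep.quasiInvariants (A : TopRep k G) (n : ℕ) : AddSubgroup (resolutionX A n) where
  carrier := {h | (d A n).hom h ∈ (resolutionX A (n + 1)).ρ.invariants}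
  zero_mem' := by simp
  add_mem' ha hb := by
    rw [Set.mem_ofPred_eq, map_add]; exact add_mem ha hb
  neg_mem' ha := by
    rw [Set.mem_ofPred_eq, map_neg]; exact neg_mem ha

/-- `H^(n+1)(G, A)` consists of the classes of `d h` with `h` quasi-invariant, and the class of
`d h` is zero iff `d h` is the differential of an invariant element. -/
theorem TopRep.exists_presentation (A : TopRep k G) (n : ℕ) :
    ∃ Φ : quasiInvariants A (n + 1) →+ continuousCohomology (n + 1) A, Function.Surjective Φ ∧
      ∀ z, Φ z = 0 ↔ ∃ y : resolutionX A (n + 1), (∀ g, (resolutionX A (n + 1)).ρ g y = y) ∧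
        (d A (n + 1)).hom y = (d A (n + 1)).hom z.1 := by
  obtain ⟨Ψ, hs, h0⟩ := TopModuleCat.exists_homology_presentation
    ((homogeneousCochains A).sc' n (n + 1) (n + 2))
  let e := (homogeneousCochains A).homologyIsoSc' n (n + 1) (n + 2)
    (CochainComplex.prev_nat_succ n) (CochainComplex.next _ _)
  have hinj : Function.Injective e.inv.hom := fun a b h => by
    have := congrArg e.hom.hom h
    rwa [← ConcreteCategory.comp_apply, ← ConcreteCategory.comp_apply, e.inv_hom_id] at this
  have hsurj : Function.Surjective e.inv.hom := fun a =>
    ⟨e.hom.hom a, by rw [← ConcreteCategory.comp_apply, e.hom_inv_id]; rfl⟩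
  let δ : quasiInvariants A (n + 1) →+
      (((homogeneousCochains A).sc' n (n + 1) (n + 2)).g.hom.ker) :=
    { toFun := fun h => ⟨⟨(d A (n + 1)).hom h.1, h.2⟩, by
        refine Subtype.ext ?_
        refine (homogeneousCochains.d_apply A (n + 1) _).trans ?_
        exact d_d A (n + 1) h.1⟩
      map_zero' := Subtype.ext (Subtype.ext (map_zero (d A (n + 1)).hom))
      map_add' := fun a b => Subtype.ext (Subtype.ext (map_add (d A (n + 1)).hom a.1 b.1)) }
  have hδ : Function.Surjective δ := fun ⟨⟨f, hf⟩, hf'⟩ => by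
    have h1 := d_eval_one A (n + 1) f
      ((homogeneousCochains.d_apply A (n + 1) ⟨f, hf⟩).symm.trans (congrArg Subtype.val hf'))
    refine ⟨⟨(f : C(G, resolutionX A (n + 1))) 1, ?_⟩, Subtype.ext (Subtype.ext h1)⟩
    change (d A (n + 1)).hom _ ∈ (resolutionX A (n + 2)).ρ.invariants
    rw [h1]
    exact hf
  refine ⟨(e.inv.hom.toLinearMap.toAddMonoidHom.comp Ψ).comp δ,
    (hsurj.comp hs).comp hδ, fun z => ?_⟩
  refine (map_eq_zero_iff e.inv.hom hinj).trans ?_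
  refine (h0 (δ z)).trans ?_
  refine ⟨fun ⟨y, hy⟩ => ⟨y.1, y.2, ?_⟩, fun ⟨y, hy, hyz⟩ => ⟨⟨y, hy⟩, Subtype.ext ?_⟩⟩
  · exact (homogeneousCochains.d_apply A n y).symm.trans (congrArg Subtype.val hy)
  · exact (homogeneousCochains.d_apply A n ⟨y, hy⟩).trans hyz

end Cohomology

/-! ### Discrete modules over compact groups -/

section Discrete

theorem ContinuousMap.discreteTopology {X Y : Type*} [TopologicalSpace X] [CompactSpace X]
    [TopologicalSpace Y] [DiscreteTopology Y] : DiscreteTopology C(X, Y) := by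
  refine discreteTopology_iff_isOpen_singleton.2 fun f => ?_
  have hfin : (Set.range f).Finite := (isCompact_range f.continuous).finite_of_discrete
  have : ({f} : Set C(X, Y)) = ⋂ y ∈ Set.range f, {g : C(X, Y) | Set.MapsTo g (f ⁻¹' {y}) {y}} := by
    ext g
    simp only [Set.mem_singleton_iff, Set.mem_iInter, Set.mem_ofPred_eq]
    refine ⟨?_, fun h => ContinuousMap.ext fun x => h (f x) ⟨x, rfl⟩ rfl⟩
    rintro rfl y - x hx
    exact hx
  rw [this]
  exact hfin.isOpen_biInter fun y _ => ContinuousMap.isOpen_setOfPred_mapsTo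
    (((isClosed_discrete {y}).preimage f.continuous).isCompact) (isOpen_discrete _)

theorem ContinuousMap.isAddTorsion {X Y : Type*} [TopologicalSpace X] [CompactSpace X]
    [TopologicalSpace Y] [DiscreteTopology Y] [AddCommGroup Y] [IsTopologicalAddGroup Y]
    (hY : IsAddTorsion Y) : IsAddTorsion C(X, Y) := by
  intro f
  have hfin : (Set.range f).Finite := (isCompact_range f.continuous).finite_of_discrete
  refine isOfFinAddOrder_iff_nsmul_eq_zero.2 ⟨∏ y ∈ hfin.toFinset, addOrderOf y, ?_, ?_⟩
  · exact Finset.prod_pos fun y _ => (hY y).addOrderOf_pos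
  · ext x
    exact addOrderOf_dvd_iff_nsmul_eq_zero.1 (Finset.dvd_prod_of_mem _ (by simp))

variable {k : Type*} [Ring k] [TopologicalSpace k]
variable {G : Type*} [Group G] [TopologicalSpace G] [CompactSpace G]

/-- In a discrete torsion module over a compact group, every finite set generates a finite
submodule. -/
theorem exists_finite_stable_addSubgroup {M : Type*} [AddCommGroup M] [TopologicalSpace M]
    [DiscreteTopology M] [DistribMulAction G M] [ContinuousSMul G M] (hM : IsAddTorsion M)
    {T : Set M} (hT : T.Finite) :
    ∃ S : AddSubgroup M, Finite S ∧ T ⊆ S ∧ (∀ (g : G), ∀ m ∈ S, g • m ∈ S) ∧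
      ∀ S' : AddSubgroup M, T ⊆ S' → (∀ (g : G), ∀ m ∈ S', g • m ∈ S') → S ≤ S' := by
  have hfin : (Set.image2 (fun (g : G) m => g • m) Set.univ T).Finite := by
    rw [← Set.image_prod]
    exact ((isCompact_univ.prod hT.isCompact).image continuous_smul).finite_of_discrete
  refine ⟨AddSubgroup.closure (Set.image2 (fun (g : G) m => g • m) Set.univ T), ?_, ?_, ?_, ?_⟩
  · have : AddGroup.FG (AddSubgroup.closure (Set.image2 (fun (g : G) m => g • m) Set.univ T)) :=
      (AddGroup.fg_iff_addSubgroup_fg _).2 ((AddSubgroup.fg_iff _).2 ⟨_, rfl, hfin⟩)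
    exact AddCommGroup.finite_of_fg_isAddTorsion _ (hM.addSubgroup _)
  · exact fun m hm => AddSubgroup.subset_closure ⟨1, trivial, m, hm, one_smul _ _⟩
  · intro g m hm
    induction hm using AddSubgroup.closure_induction with
    | mem x hx =>
      obtain ⟨g', -, m, hm, rfl⟩ := hx
      exact AddSubgroup.subset_closure ⟨g * g', trivial, m, hm, mul_smul _ _ _⟩
    | zero => simp
    | add x y _ _ hx hy => rw [smul_add]; exact add_mem hx hy
    | neg x _ hx => rw [smul_neg]; exact neg_mem hx
  · intro S' hTS hS'
    rw [AddSubgroup.closure_le]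
    rintro _ ⟨g, -, m, hm, rfl⟩
    exact hS' g m (hTS hm)

variable [IsTopologicalGroup G]
/-- The joint continuity of the action, which a `TopRep` does not include, is inherited by the
standard resolution when `A` is discrete and `G` is compact. -/
theorem TopRep.resolutionX_discrete (A : TopRep k G) (hA : DiscreteTopology A)
    (hc : Continuous fun x : G × A => A.ρ x.1 x.2) (n : ℕ) :
    DiscreteTopology (resolutionX A n) ∧
      Continuous fun x : G × resolutionX A n => (resolutionX A n).ρ x.1 x.2 := by
  induction n with
  | zero => exact ⟨hA, hc⟩
  | succ n ih =>
    obtain ⟨h1, h2⟩ := ih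
    have h3 : DiscreteTopology (resolutionX A (n + 1)) := ContinuousMap.discreteTopology
    refine ⟨h3, continuous_prod_of_discrete_right.2 fun f => ?_⟩
    let F : C(G, C(G, resolutionX A n)) := ContinuousMap.curry
      ⟨fun q : G × G => (resolutionX A n).ρ q.1 ((f : C(G, resolutionX A n)) (q.1⁻¹ * q.2)),
        h2.comp (continuous_fst.prodMk (by fun_prop))⟩
    exact F.continuous

theorem TopRep.resolutionX_isAddTorsion (A : TopRep k G) (hA : DiscreteTopology A)
    (hc : Continuous fun x : G × A => A.ρ x.1 x.2) (ht : IsAddTorsion A) (n : ℕ) :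
    IsAddTorsion (resolutionX A n) := by
  induction n with
  | zero => exact ht
  | succ n ih =>
    have := (resolutionX_discrete A hA hc n).1
    exact ContinuousMap.isAddTorsion ih

/-- `H^1(G, C(G, A)) = 0` for a discrete module `A`, in terms of crossed homomorphisms. -/
theorem TopRep.exists_of_cocycle_coind₁ (A : TopRep k G) (hA : DiscreteTopology A)
    (e : G → C(G, A)) (he : Continuous e)
    (hc : ∀ g h, e (g * h) = e g + A.ρ.coind₁ g (e h)) :
    ∃ y : C(G, A), ∀ g, e g = A.ρ.coind₁ g y - y := by
  have := ContinuousMap.discreteTopology (X := G) (Y := A)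
  have hev : Continuous fun q : C(G, A) × G => q.1 q.2 :=
    continuous_prod_of_discrete_left.2 fun f => f.continuous
  refine ⟨⟨fun x => -(e x x), (hev.comp (he.prodMk continuous_id)).neg⟩, fun g => ?_⟩
  ext x
  have h := congrArg (fun f : C(G, A) => f x) (hc g (g⁻¹ * x))
  simp only [mul_inv_cancel_left, ContinuousMap.add_apply, coind₁_apply_apply] at h
  simp only [ContinuousMap.sub_apply, coind₁_apply_apply, ContinuousMap.coe_mk, h, map_neg]
  abel

end Discrete

/-! ### Vanishing in degrees at least two -/

section Vanishing

variable {G : Type u} [Group G] [TopologicalSpace G]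

/-- Every continuous inhomogeneous `2`-cocycle of `G` with values in a finite discrete `p`-primary
`G`-module is the coboundary of a continuous cochain. -/
def TwoCocyclesSplit (G : Type u) [Group G] [TopologicalSpace G] (p : ℕ) : Prop :=
  ∀ (M : Type u) [AddCommGroup M] [Finite M] [TopologicalSpace M] [DiscreteTopology M]
    [DistribMulAction G M] [ContinuousSMul G M] (z : G → G → M),
    (Continuous fun q : G × G => z q.1 q.2) →
    (∀ g h k, g • z h k + z g (h * k) = z (g * h) k + z g h) →
    (∃ a : ℕ, ∀ m : M, p ^ a • m = 0) →
    ∃ b : G → M, Continuous b ∧ ∀ g h, z g h = g • b h - b (g * h) + b g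

/-- The coboundary property for cocycles in a module `M` with values in a finite submodule `S`; the
cochain again takes its values in `S`. -/
theorem TwoCocyclesSplit.exists_of_stable_addSubgroup {p : ℕ} (H : TwoCocyclesSplit G p)
    {M : Type u} [AddCommGroup M] [TopologicalSpace M]
    [DiscreteTopology M] [DistribMulAction G M] [ContinuousSMul G M] (S : AddSubgroup M) [Finite S]
    (hS : ∀ (g : G), ∀ m ∈ S, g • m ∈ S) (z : G → G → M)
    (hz : Continuous fun q : G × G => z q.1 q.2)
    (hzc : ∀ g h k, g • z h k + z g (h * k) = z (g * h) k + z g h)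
    (hzS : ∀ g h, z g h ∈ S) (a : ℕ) (ha : ∀ m ∈ S, p ^ a • m = 0) :
    ∃ b : G → M, Continuous b ∧ (∀ g, b g ∈ S) ∧ ∀ g h, z g h = g • b h - b (g * h) + b g := by
  let : DistribMulAction G S :=
    { smul := fun g m => ⟨g • m.1, hS g _ m.2⟩
      one_smul := fun m => Subtype.ext (one_smul G m.1)
      mul_smul := fun g h m => Subtype.ext (mul_smul g h m.1)
      smul_zero := fun g => Subtype.ext (smul_zero g)
      smul_add := fun g m n => Subtype.ext (smul_add g m.1 n.1) }
  have : ContinuousSMul G S := ⟨Continuous.subtype_mk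
    (continuous_fst.smul (continuous_subtype_val.comp continuous_snd)) _⟩
  obtain ⟨b, hb, hbz⟩ := H S (fun g h => ⟨z g h, hzS g h⟩) (hz.subtype_mk _)
    (fun g h k => Subtype.ext (hzc g h k)) ⟨a, fun m => Subtype.ext (ha _ m.2)⟩
  exact ⟨fun g => b g, continuous_subtype_val.comp hb, fun g => (b g).2,
    fun g h => congrArg Subtype.val (hbz g h)⟩

/-- Dimension shifting for `δ : X ⟶ Y`, where `X` has no first cohomology: if `h` is invariant
modulo the image of `δ`, then a multiple of `h` by an integer prime to `p` is the sum of an invariant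
element and an element of the image of `δ`. -/
theorem TwoCocyclesSplit.exists_invariant_sub [IsTopologicalGroup G] [CompactSpace G] {p : ℕ}
    (hp : p.Prime) (H : TwoCocyclesSplit G p) {k : Type*} [Ring k] [TopologicalSpace k]
    {X Y : TopRep.{u} k G} (δ : X ⟶ Y) (hX : DiscreteTopology X)
    (hc : Continuous fun x : G × X => X.ρ x.1 x.2) (ht : IsAddTorsion X)
    (hX1 : ∀ e : G → X, Continuous e → (∀ g h, e (g * h) = e g + X.ρ g (e h)) →
      ∃ y, ∀ g, e g = X.ρ g y - y)
    (h : Y) (e : G → X) (he : Continuous e) (hδe : ∀ g, δ.hom (e g) = Y.ρ g h - h) :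
    ∃ m : ℕ, ¬ p ∣ m ∧ ∃ y : X, ∀ g, Y.ρ g (m • h - δ.hom y) = m • h - δ.hom y := by
  let _ : DistribMulAction G X :=
    { smul := fun g m => X.ρ g m
      one_smul := fun m => congrArg (fun f => f m) (map_one X.ρ)
      mul_smul := fun g h m => congrArg (fun f => f m) (map_mul X.ρ g h)
      smul_zero := fun g => map_zero (X.ρ g)
      smul_add := fun g m n => map_add (X.ρ g) m n }
  have hsmul : ∀ (g : G) (x : X), X.ρ g x = g • x := fun _ _ => rfl
  have : ContinuousSMul G X := ⟨hc⟩
  have hsn : ∀ (g : G) (n : ℕ) (x : X), g • n • x = n • g • x := fun g n x => map_nsmul (X.ρ g) n x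
  have hδ : ∀ (g : G) (m : X), δ.hom (g • m) = Y.ρ g (δ.hom m) := hom_comm_apply δ
  have hmul : ∀ (g h : G) (y : Y), Y.ρ (g * h) y = Y.ρ g (Y.ρ h y) :=
    fun g h y => congrArg (fun f => f y) (map_mul Y.ρ g h)
  let z : G → G → X := fun g k => g • e k - e (g * k) + e g
  have hz : Continuous fun q : G × G => z q.1 q.2 := by
    refine ((continuous_fst.smul (he.comp continuous_snd)).sub (he.comp ?_)).add
      (he.comp continuous_fst)
    exact continuous_fst.mul continuous_snd
  have hzc : ∀ g h k, g • z h k + z g (h * k) = z (g * h) k + z g h := fun g h k => by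
    simp only [z, smul_add, smul_sub, mul_smul, mul_assoc]
    abel
  have hzδ : ∀ g k, δ.hom (z g k) = 0 := fun g k => by
    simp only [z, map_add, map_sub, hδ, hδe, hmul]
    abel
  -- the coboundary of `e` takes its values in a finite submodule `S` of the kernel of `δ`
  obtain ⟨S, hSfin, hzS, hSG, hSmin⟩ := exists_finite_stable_addSubgroup (G := G) ht
    (T := Set.range fun q : G × G => z q.1 q.2) (isCompact_range hz).finite_of_discrete
  have hzS' : ∀ g k, z g k ∈ S := fun g k => hzS ⟨(g, k), rfl⟩
  have hSδ : ∀ m ∈ S, δ.hom m = 0 :=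
    hSmin (δ.hom : X →+ Y).ker (by rintro _ ⟨q, rfl⟩; exact hzδ _ _) fun g m hm => by
      have hm : δ.hom m = 0 := hm
      change δ.hom (g • m) = 0
      rw [hδ, hm, map_zero]
  obtain ⟨c, m, hpm, hcard⟩ := Nat.exists_eq_pow_mul_and_not_dvd
    (Nat.card_pos (α := S)).ne' p hp.ne_one
  -- `m • z` takes its values in the `p`-primary part of `S`
  let S' : AddSubgroup X := S.map (nsmulAddMonoidHom m)
  have hS'S : ∀ x ∈ S', x ∈ S := by
    rintro _ ⟨x, hx, rfl⟩
    exact nsmul_mem hx m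
  have : Finite S' := (Set.Finite.image _ (Set.toFinite (S : Set X))).to_subtype
  obtain ⟨b, hb, hbS, hbz⟩ := H.exists_of_stable_addSubgroup S'
    (by rintro g _ ⟨x, hx, rfl⟩; exact ⟨g • x, hSG g x hx, (hsn g m x).symm⟩)
    (fun g k => m • z g k) (hz.const_smul m)
    (fun g h k => by rw [hsn, ← smul_add, hzc, smul_add])
    (fun g k => ⟨z g k, hzS' g k, rfl⟩) c (by
      rintro _ ⟨x, hx, rfl⟩
      rw [nsmulAddMonoidHom_apply, ← mul_smul, ← hcard]
      exact congrArg Subtype.val (card_nsmul_eq_zero' (x := (⟨x, hx⟩ : S))))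
  -- `b` is killed by `δ`, so subtracting it from `m • e` does not change the image under `δ`
  obtain ⟨y, hy⟩ := hX1 (fun g => m • e g - b g) ((he.const_smul m).sub hb) (fun g k => by
    have := hbz g k
    simp only [z, smul_add, smul_sub] at this
    rw [hsmul, smul_sub, hsn]
    generalize g • e k = u, g • b k = v at this ⊢
    linear_combination (norm := module) (-1 : ℤ) • this)
  refine ⟨m, hpm, y, fun g => ?_⟩
  have h1 := congrArg δ.hom (hy g)
  rw [map_sub, map_sub, hSδ _ (hS'S _ (hbS g)), map_nsmul, hδe, hsmul, hδ, sub_zero] at h1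
  rw [map_sub, map_nsmul]
  linear_combination (norm := module) (1 : ℤ) • h1

/-- Vanishing of `H^q(G, A)(p)` for `q ≥ 2`, by dimension shifting along the resolution down to
`2`-cocycles with finite values. -/
theorem TwoCocyclesSplit.eq_zero_of_pow_smul_eq_zero [IsTopologicalGroup G] [CompactSpace G] {p : ℕ}
    (hp : p.Prime) (H : TwoCocyclesSplit G p) {k : Type*} [Ring k] [TopologicalSpace k]
    (A : TopRep.{u} k G) (hA : DiscreteTopology A)
    (hc : Continuous fun x : G × A => A.ρ x.1 x.2) (ht : IsAddTorsion A) (n a : ℕ)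
    (x : continuousCohomology (n + 2) A) (hx : p ^ a • x = 0) : x = 0 := by
  obtain ⟨Φ, hΦ, hΦ0⟩ := exists_presentation A (n + 1)
  obtain ⟨h, rfl⟩ := hΦ x
  obtain ⟨hd, hcont⟩ := resolutionX_discrete A hA hc (n + 1)
  obtain ⟨hd₀, -⟩ := resolutionX_discrete A hA hc n
  obtain ⟨-, hcont'⟩ := resolutionX_discrete A hA hc (n + 2)
  have htor := resolutionX_isAddTorsion A hA hc ht (n + 1)
  let ρ := (resolutionX A (n + 2)).ρ
  obtain ⟨m, hpm, y, hy⟩ := H.exists_invariant_sub hp (d A (n + 1)) hd hcont htor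
    (exists_of_cocycle_coind₁ (resolutionX A n) hd₀) h.1
    (fun g => (show C(G, resolutionX A (n + 1)) from ρ g h.1 - h.1) 1)
    ((continuous_eval_const (1 : G)).comp
      ((hcont'.comp (continuous_id.prodMk continuous_const)).sub continuous_const))
    (fun g => by
      refine d_eval_one A (n + 1) _ ?_
      refine (map_sub (d A (n + 2)).hom (ρ g h.1) h.1).trans (sub_eq_zero.2 ?_)
      exact (d_smul A (n + 2) g h.1).trans (h.2 g))
  have hm : m • Φ h = 0 := by
    rw [← map_nsmul]
    refine (hΦ0 _).2 ⟨_, hy, ?_⟩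
    refine (map_sub (d A (n + 2)).hom (m • h.1) _).trans ?_
    exact (congrArg _ (d_d A (n + 1) y)).trans (sub_zero _)
  -- the class is killed both by a power of `p` and by `m`, which is prime to `p`
  have h1 : addOrderOf (Φ h) ∣ Nat.gcd (p ^ a) m :=
    Nat.dvd_gcd (addOrderOf_dvd_of_nsmul_eq_zero hx) (addOrderOf_dvd_of_nsmul_eq_zero hm)
  rw [Nat.Coprime.gcd_eq_one (Nat.Coprime.pow_left a ((Nat.Prime.coprime_iff_not_dvd hp).2 hpm)),
    Nat.dvd_one] at h1
  exact AddMonoid.addOrderOf_eq_one_iff.1 h1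

end Vanishing

/-! ### Inhomogeneous cocycles in degrees one and two -/

section LowDegree

variable {k : Type*} [Ring k] [TopologicalSpace k]
variable {G : Type*} [Group G] [TopologicalSpace G]

/-- A continuous inhomogeneous `1`-cocycle, also called a continuous crossed homomorphism. -/
def TopRep.IsOneCocycle (A : TopRep k G) (c : G → A) : Prop :=
  Continuous c ∧ ∀ g h, c (g * h) = c g + A.ρ g (c h)

theorem TopRep.IsOneCocycle.map_one {A : TopRep k G} {c : G → A} (hc : A.IsOneCocycle c) :
    c 1 = 0 := by
  have h := hc.2 1 1
  rw [mul_one, _root_.map_one A.ρ] at h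
  exact left_eq_add.1 h

variable [IsTopologicalGroup G]

/-- The function `-c` is invariant up to constants, as `g • (-c) - (-c)` is the constant `c g`. -/
lemma TopRep.IsOneCocycle.neg_mem_quasiInvariants {A : TopRep k G} {c : G → A}
    (hc : A.IsOneCocycle c) :
    (show resolutionX A 1 from (⟨fun g => -c g, hc.1.neg⟩ : C(G, A))) ∈ quasiInvariants A 1 := by
  intro g
  refine (d_smul A 1 g _).symm.trans (sub_eq_zero.1 ?_)
  refine (map_sub (d A 1).hom _ _).symm.trans ?_
  have : (resolutionX A 1).ρ g (⟨fun g => -c g, hc.1.neg⟩ : C(G, A)) -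
      (⟨fun g => -c g, hc.1.neg⟩ : C(G, A)) = (d A 0).hom (c g) := by
    refine ContinuousMap.ext fun x => ?_
    have h := hc.2 g (g⁻¹ * x)
    rw [mul_inv_cancel_left] at h
    change A.ρ g (-c (g⁻¹ * x)) - -c x = c g
    rw [h, map_neg]
    abel
  refine (congrArg _ this).trans (d_d A 0 (c g))

/-- Every class in `H^1(G, A)` comes from a crossed homomorphism, and two crossed homomorphisms with
the same class differ by a principal one. -/
theorem TopRep.exists_oneCocycle_presentation (A : TopRep k G)
    (hA : Continuous fun x : G × A => A.ρ x.1 x.2) :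
    ∃ Ψ : {c : G → A // A.IsOneCocycle c} → continuousCohomology 1 A, Function.Surjective Ψ ∧
      ∀ c c', Ψ c = Ψ c' → ∃ a, ∀ g, c.1 g - c'.1 g = A.ρ g a - a := by
  obtain ⟨Φ, hΦ, hΦ0⟩ := exists_presentation A 0
  have hmul : ∀ (g h : G) (y : A), A.ρ (g * h) y = A.ρ g (A.ρ h y) :=
    fun g h y => congrArg (fun f => f y) (map_mul A.ρ g h)
  refine ⟨fun c => Φ ⟨_, c.2.neg_mem_quasiInvariants⟩, fun x => ?_, fun c c' hcc => ?_⟩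
  · obtain ⟨⟨h, hh⟩, rfl⟩ := hΦ x
    let f : C(G, A) := h
    have hd : ∀ g, ∃ a : A, ∀ x, A.ρ g (f (g⁻¹ * x)) - f x = a := fun g => by
      have h0 : (d A 1).hom ((resolutionX A 1).ρ g h - h) = 0 :=
        (map_sub (d A 1).hom _ _).trans (sub_eq_zero.2 ((d_smul A 1 g h).trans (hh g)))
      have h1 := d_eval_one A 0 _ h0
      exact ⟨_, fun x => (congrArg (fun F : C(G, A) => F x) h1).symm⟩
    have hd' : ∀ g x y, A.ρ g (f (g⁻¹ * x)) - f x = A.ρ g (f (g⁻¹ * y)) - f y := fun g x y => by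
      obtain ⟨a, ha⟩ := hd g
      rw [ha, ha]
    have hy : Continuous fun g => A.ρ g (f 1) := hA.comp (continuous_id.prodMk continuous_const)
    have hc : A.IsOneCocycle fun g => A.ρ g (f 1) - f g := by
      refine ⟨hy.sub f.continuous, fun g h => ?_⟩
      have h1 := hd' g (g * h) g
      rw [inv_mul_cancel_left, inv_mul_cancel] at h1
      beta_reduce
      rw [hmul, map_sub]
      linear_combination (norm := module) (1 : ℤ) • h1
    refine ⟨⟨_, hc⟩, ?_⟩
    rw [← sub_eq_zero, ← map_sub, hΦ0]
    refine ⟨_, fun g => ContinuousMap.ext fun x => ?_, rfl⟩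
    change A.ρ g (-(A.ρ (g⁻¹ * x) (f 1) - f (g⁻¹ * x)) - f (g⁻¹ * x)) =
      -(A.ρ x (f 1) - f x) - f x
    rw [neg_sub, sub_sub_cancel_left, map_neg, ← hmul, mul_inv_cancel_left]
    abel
  · rw [← sub_eq_zero, ← map_sub, hΦ0] at hcc
    obtain ⟨y, hy, hyd⟩ := hcc
    have h0 := d_eval_one A 0 _ ((map_sub (d A 1).hom _ _).trans (sub_eq_zero.2 hyd))
    let f : C(G, A) := y
    have hf : ∀ g, f g = A.ρ g (f 1) := fun g => by
      have := congrArg (fun F : C(G, A) => F g) (hy g)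
      change A.ρ g (f (g⁻¹ * g)) = f g at this
      rw [inv_mul_cancel] at this
      exact this.symm
    have h1 : ∀ g, f 1 - (-c.1 1 - -c'.1 1) = f g - (-c.1 g - -c'.1 g) :=
      fun g => congrArg (fun F : C(G, A) => F g) h0
    refine ⟨-f 1, fun g => ?_⟩
    have h2 := h1 g
    rw [c.2.map_one, c'.2.map_one, hf g] at h2
    rw [map_neg]
    linear_combination (norm := module) (-1 : ℤ) • h2

/-- If `H^2(G, A)` has no nonzero element killed by `p`, and `p` kills `A`, then every inhomogeneous
`2`-cocycle is a coboundary. The homogeneous cocycle attached to `z` is the differential of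
`(x, y) ↦ z x (x⁻¹ * y)`. -/
theorem TopRep.exists_twoCochain_of_eq_zero (A : TopRep k G) (p : ℕ)
    (hpA : ∀ a : A, p • a = 0)
    (h2 : ∀ x : continuousCohomology 2 A, p • x = 0 → x = 0)
    (z : G → G → A) (hz : Continuous fun q : G × G => z q.1 q.2)
    (hzc : ∀ g h k, A.ρ g (z h k) + z g (h * k) = z (g * h) k + z g h) :
    ∃ b : G → A, Continuous b ∧ ∀ g h, z g h = A.ρ g (b h) - b (g * h) + b g := by
  obtain ⟨Φ, hΦ, hΦ0⟩ := exists_presentation A 1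
  let h : C(G, C(G, A)) := ContinuousMap.curry ⟨fun q : G × G => z q.1 (q.1⁻¹ * q.2),
    hz.comp (continuous_fst.prodMk (continuous_fst.inv.mul continuous_snd))⟩
  have hf : ∀ x₀ x₁ x₂, (((d A 2).hom h : C(G, C(G, C(G, A)))) x₀) x₁ x₂ =
      A.ρ x₀ (z (x₀⁻¹ * x₁) (x₁⁻¹ * x₂)) := fun x₀ x₁ x₂ => by
    change z x₁ (x₁⁻¹ * x₂) - (z x₀ (x₀⁻¹ * x₂) - z x₀ (x₀⁻¹ * x₁)) = _
    have h1 := hzc x₀ (x₀⁻¹ * x₁) (x₁⁻¹ * x₂)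
    rw [show x₀⁻¹ * x₁ * (x₁⁻¹ * x₂) = x₀⁻¹ * x₂ by group, mul_inv_cancel_left] at h1
    linear_combination (norm := module) (-1 : ℤ) • h1
  have hmul : ∀ (g h : G) (y : A), A.ρ (g * h) y = A.ρ g (A.ρ h y) :=
    fun g h y => congrArg (fun f => f y) (map_mul A.ρ g h)
  have hh : (show resolutionX A 2 from h) ∈ quasiInvariants A 2 := by
    refine fun g => ContinuousMap.ext fun x₀ => ContinuousMap.ext fun x₁ =>
      ContinuousMap.ext fun x₂ => ?_
    refine Eq.trans ?_ (hf x₀ x₁ x₂).symm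
    change A.ρ g ((((d A 2).hom h : C(G, C(G, C(G, A)))) (g⁻¹ * x₀)) (g⁻¹ * x₁) (g⁻¹ * x₂)) = _
    rw [hf, ← hmul, mul_inv_cancel_left]
    congr 2 <;> group
  have hph : p • (⟨h, hh⟩ : quasiInvariants A 2) = 0 :=
    Subtype.ext (ContinuousMap.ext fun x₀ => ContinuousMap.ext fun x₁ => hpA _)
  obtain ⟨y, hy, hyd⟩ := (hΦ0 _).1 (h2 (Φ ⟨h, hh⟩) (by rw [← map_nsmul, hph, map_zero]))
  let f : C(G, C(G, A)) := y
  have hfy : ∀ x₀ x₁ x₂, f x₁ x₂ - (f x₀ x₂ - f x₀ x₁) =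
      A.ρ x₀ (z (x₀⁻¹ * x₁) (x₁⁻¹ * x₂)) := fun x₀ x₁ x₂ => by
    rw [← hf]
    exact congrArg (fun F : C(G, C(G, C(G, A))) => F x₀ x₁ x₂) hyd
  have hinv : ∀ g x, f g (g * x) = A.ρ g (f 1 x) := fun g x => by
    have := congrArg (fun F : C(G, C(G, A)) => F g (g * x)) (hy g)
    change A.ρ g (f (g⁻¹ * g) (g⁻¹ * (g * x))) = f g (g * x) at this
    rw [inv_mul_cancel, inv_mul_cancel_left] at this
    exact this.symm
  refine ⟨f 1, (f 1).continuous, fun g h => ?_⟩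
  have h1 := hfy 1 g (g * h)
  rw [inv_one, one_mul, inv_mul_cancel_left, hinv, map_one A.ρ] at h1
  refine h1.symm.trans ?_
  abel

end LowDegree

/-! ### The group extension defined by a two-cocycle -/

section Extension

/-- An inhomogeneous `2`-cocycle, not necessarily normalized. -/
structure TwoCocycle (Q M : Type*) [Group Q] [AddCommGroup M] [DistribMulAction Q M] where
  /-- The underlying function of two variables. -/
  toFun : Q → Q → M
  cocycle : ∀ g h k, g • toFun h k + toFun g (h * k) = toFun (g * h) k + toFun g h

variable {Q M : Type*} [Group Q] [AddCommGroup M] [DistribMulAction Q M]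

/-- The extension of `Q` by `M` defined by the cocycle `z`: pairs `(m, q)` with the product
`(m, q) * (n, r) = (m + q • n + z q r, q * r)`. As `z` need not be normalized, the identity is
`(-z 1 1, 1)`. -/
@[ext]
structure TwoCocycle.Extension (z : TwoCocycle Q M) where
  /-- The component in the module. -/
  left : M
  /-- The component in the quotient. -/
  right : Q

namespace TwoCocycle.Extension

variable {z : TwoCocycle Q M}

instance : Mul z.Extension :=
  ⟨fun x y => ⟨x.left + x.right • y.left + z.toFun x.right y.right, x.right * y.right⟩⟩

instance : One z.Extension := ⟨⟨-z.toFun 1 1, 1⟩⟩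

instance : Inv z.Extension :=
  ⟨fun x => ⟨-(x.right⁻¹ • x.left) - z.toFun x.right⁻¹ x.right - z.toFun 1 1, x.right⁻¹⟩⟩

lemma mul_left (x y : z.Extension) :
    (x * y).left = x.left + x.right • y.left + z.toFun x.right y.right := rfl

lemma mul_right (x y : z.Extension) : (x * y).right = x.right * y.right := rfl

lemma toFun_one_left (q : Q) : z.toFun 1 q = z.toFun 1 1 := by
  have h := z.cocycle 1 1 q
  rw [one_smul, one_mul, one_mul] at h
  exact add_left_cancel h

instance : Group z.Extension :=
  Group.ofLeftAxioms
    (fun x y w => by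
      refine Extension.ext ?_ (mul_assoc _ _ _)
      have h := z.cocycle x.right y.right w.right
      simp only [mul_left, mul_right, smul_add, mul_smul]
      generalize x.right • z.toFun y.right w.right = t, x.right • y.right • w.left = s,
        x.right • y.left = r at *
      linear_combination (norm := module) (-1 : ℤ) • h)
    (fun x => by
      refine Extension.ext ?_ (one_mul _)
      change -z.toFun 1 1 + (1 : Q) • x.left + z.toFun 1 x.right = x.left
      rw [one_smul, toFun_one_left x.right]
      abel)
    (fun x => by
      refine Extension.ext ?_ (inv_mul_cancel _)
      change -(x.right⁻¹ • x.left) - z.toFun x.right⁻¹ x.right - z.toFun 1 1 + x.right⁻¹ • x.left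
        + z.toFun x.right⁻¹ x.right = -z.toFun 1 1
      abel)

variable (z) in
/-- The underlying set of the extension is the product. -/
def equivProd : z.Extension ≃ M × Q where
  toFun x := (x.left, x.right)
  invFun x := ⟨x.1, x.2⟩

instance [Finite M] [Finite Q] : Finite z.Extension := Finite.of_equiv _ (equivProd z).symm

variable (z) in
/-- The projection onto the quotient. -/
def rightHom : z.Extension →* Q where
  toFun := right
  map_one' := rfl
  map_mul' _ _ := rfl

lemma isPGroup_ker_rightHom {p : ℕ} [Fact p.Prime] [Finite M] {a : ℕ}
    (hM : ∀ m : M, p ^ a • m = 0) : IsPGroup p (rightHom z).ker := by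
  have hM' : IsPGroup p (Multiplicative M) := fun m => ⟨a, hM m⟩
  obtain ⟨n, hn⟩ := IsPGroup.iff_card.1 hM'
  let e : (rightHom z).ker ≃ Multiplicative M :=
    { toFun := fun x => Multiplicative.ofAdd x.1.left
      invFun := fun m => ⟨⟨m.toAdd, 1⟩, rfl⟩
      left_inv := fun x => Subtype.ext (Extension.ext rfl (MonoidHom.mem_ker.1 x.2).symm)
      right_inv := fun m => rfl }
  exact IsPGroup.of_card ((Nat.card_congr e).trans hn)

end TwoCocycle.Extension

end Extension

/-! ### From proper solutions to cohomology -/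

section Lift

theorem exists_openNormalSubgroup_right_invariant {G Y : Type*} [Group G] [TopologicalSpace G]
    [IsTopologicalGroup G] [CompactSpace G] [TotallyDisconnectedSpace G] [TopologicalSpace Y]
    [DiscreteTopology Y] {f : G → Y} (hf : Continuous f) :
    ∃ U : OpenNormalSubgroup G, ∀ g, ∀ u ∈ U, f (g * u) = f g := by
  have := ContinuousMap.discreteTopology (X := G) (Y := Y)
  let F : C(G, C(G, Y)) := ContinuousMap.curry
    ⟨fun q : G × G => f (q.2 * q.1), hf.comp (continuous_snd.mul continuous_fst)⟩
  obtain ⟨U, hU⟩ := ProfiniteGrp.exist_openNormalSubgroup_sub_open_nhds_of_one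
    ((isOpen_discrete {F 1}).preimage F.continuous) rfl
  refine ⟨U, fun g u hu => ?_⟩
  have := congrArg (fun φ : C(G, Y) => φ g) (hU hu : F u = F 1)
  change f (g * u) = f (g * 1) at this
  rwa [mul_one] at this

variable {G : Type u} [Group G] [TopologicalSpace G] [IsTopologicalGroup G] [CompactSpace G]
  [TotallyDisconnectedSpace G]

/-- A continuous function `z` of two variables with values in a finite discrete module is inflated
from a finite quotient of `G` that acts on the module. -/
theorem exists_openNormalSubgroup_twoCocycle {M : Type*} [AddCommGroup M] [Finite M]
    [TopologicalSpace M] [DiscreteTopology M] [DistribMulAction G M] [ContinuousSMul G M]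
    {z : G → G → M} (hz : Continuous fun q : G × G => z q.1 q.2) :
    ∃ U : OpenNormalSubgroup G, ∀ u ∈ U, (∀ m : M, u • m = m) ∧
      ∀ g h, z (g * u) h = z g h ∧ z g (h * u) = z g h := by
  have := ContinuousMap.discreteTopology (X := G) (Y := M)
  have := ContinuousMap.discreteTopology (X := M) (Y := M)
  let F₁ : C(G, C(G, M)) := ContinuousMap.curry ⟨fun q : G × G => z q.1 q.2, hz⟩
  let F₂ : C(G, C(G, M)) := ContinuousMap.curry
    ⟨fun q : G × G => z q.2 q.1, hz.comp continuous_swap⟩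
  let F₃ : C(G, C(M, M)) := ContinuousMap.curry ⟨fun q : G × M => q.1 • q.2, continuous_smul⟩
  obtain ⟨U, hU⟩ := exists_openNormalSubgroup_right_invariant (f := fun g => (F₁ g, F₂ g, F₃ g))
    (F₁.continuous.prodMk (F₂.continuous.prodMk F₃.continuous))
  refine ⟨U, fun u hu => ⟨fun m => ?_, fun g h => ⟨?_, ?_⟩⟩⟩
  · have := congrArg (fun φ => φ.2.2 m) (hU 1 u hu)
    change (1 * u) • m = (1 : G) • m at this
    rwa [one_mul, one_smul] at this
  · exact congrArg (fun φ => φ.1 h) (hU g u hu)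
  · exact congrArg (fun φ => φ.2.1 g) (hU h u hu)

/-- The `M`-component of a proper solution for the extension of a finite quotient of `G` defined by
the cocycle `z`. Surjectivity gives elements over any `(m, 1)`, and these act trivially on `M`. -/
theorem exists_cochain_of_properlySolvable {p : ℕ} (hp : p.Prime)
    (H : ∀ E : EmbeddingProblem G, E.IsFinite → E.IsPProblem p → E.ProperlySolvable)
    {M : Type u} [AddCommGroup M] [Finite M]
    [TopologicalSpace M] [DiscreteTopology M] [DistribMulAction G M] [ContinuousSMul G M]
    {a : ℕ} (hM : ∀ m : M, p ^ a • m = 0)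
    {z : G → G → M} (hz : Continuous fun q : G × G => z q.1 q.2)
    (hzc : ∀ g h k, g • z h k + z g (h * k) = z (g * h) k + z g h) :
    ∃ b : G → M, Continuous b ∧ (∀ g h, b (g * h) = b g + g • b h + z g h) ∧
      ∀ m, ∃ u : G, (∀ m : M, u • m = m) ∧ b u = m := by
  have : Fact p.Prime := ⟨hp⟩
  obtain ⟨U, hU⟩ := exists_openNormalSubgroup_twoCocycle hz
  let Q := G ⧸ U.toSubgroup
  have : Finite Q := U.toSubgroup.quotient_finite_of_isOpen U.isOpen
  have : DiscreteTopology Q := QuotientGroup.discreteTopology U.isOpen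
  have hout : ∀ g : G, ∃ u ∈ U, (QuotientGroup.mk g : Q).out = g * u := fun g => by
    obtain ⟨u, hu⟩ := QuotientGroup.mk_out_eq_mul U.toSubgroup g
    exact ⟨u, u.2, hu⟩
  have hact : ∀ (g : G) (m : M), (QuotientGroup.mk g : Q).out • m = g • m := fun g m => by
    obtain ⟨u, hu, h⟩ := hout g
    rw [h, mul_smul, (hU u hu).1]
  have hzout : ∀ g h : G, z (QuotientGroup.mk g : Q).out (QuotientGroup.mk h : Q).out = z g h :=
    fun g h => by
    obtain ⟨u, hu, hg⟩ := hout g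
    obtain ⟨v, hv, hh⟩ := hout h
    rw [hg, hh, ((hU u hu).2 _ _).1, ((hU v hv).2 _ _).2]
  let _ : DistribMulAction Q M :=
    { smul := fun q m => q.out • m
      one_smul := fun m => (hact 1 m).trans (one_smul G m)
      mul_smul := fun q r m => by
        obtain ⟨g, rfl⟩ := QuotientGroup.mk_surjective q
        obtain ⟨h, rfl⟩ := QuotientGroup.mk_surjective r
        change (QuotientGroup.mk (g * h) : Q).out • m =
          (QuotientGroup.mk g : Q).out • (QuotientGroup.mk h : Q).out • m
        rw [hact, hact, hact, mul_smul]
      smul_zero := fun q => smul_zero q.out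
      smul_add := fun q => smul_add q.out }
  have hsmul : ∀ (g : G) (m : M), (QuotientGroup.mk g : Q) • m = g • m := hact
  let w : TwoCocycle Q M := ⟨fun q r => z q.out r.out, fun q r s => by
    obtain ⟨g, rfl⟩ := QuotientGroup.mk_surjective q
    obtain ⟨h, rfl⟩ := QuotientGroup.mk_surjective r
    obtain ⟨k, rfl⟩ := QuotientGroup.mk_surjective s
    rw [← QuotientGroup.mk_mul, ← QuotientGroup.mk_mul, hsmul]
    simp only [hzout]
    exact hzc g h k⟩
  let _ : TopologicalSpace w.Extension := ⊥
  have : DiscreteTopology w.Extension := ⟨rfl⟩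
  let E : EmbeddingProblem G :=
    { B := ProfiniteGrp.of w.Extension
      A := ProfiniteGrp.of Q
      α := ⟨QuotientGroup.mk' U.toSubgroup, continuous_quotient_mk'⟩
      f := ⟨TwoCocycle.Extension.rightHom w, continuous_of_discreteTopology⟩
      α_surjective := QuotientGroup.mk_surjective
      f_surjective := fun q => ⟨⟨0, q⟩, rfl⟩ }
  obtain ⟨β, hβ, hsurj⟩ := H E (inferInstanceAs (Finite w.Extension))
    (TwoCocycle.Extension.isPGroup_ker_rightHom hM)
  let β' : G →* w.Extension := β.toMonoidHom
  have hβ' : ∀ g, (β' g).right = QuotientGroup.mk g := fun g => DFunLike.congr_fun hβ g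
  refine ⟨fun g => (β' g).left, ?_, fun g h => ?_, fun m => ?_⟩
  · exact (continuous_of_discreteTopology (f := fun x : w.Extension => x.left)).comp
      β.continuous_toFun
  · change (β' (g * h)).left = _
    rw [map_mul, TwoCocycle.Extension.mul_left, hβ', hβ', hsmul]
    exact congrArg _ (hzout g h)
  · obtain ⟨u, hu⟩ := hsurj (⟨m, 1⟩ : w.Extension)
    have hu' : β' u = ⟨m, 1⟩ := hu
    refine ⟨u, (hU u ?_).1, congrArg TwoCocycle.Extension.left hu'⟩
    exact (QuotientGroup.eq_one_iff u).1 ((hβ' u).symm.trans (congrArg _ hu'))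

theorem twoCocyclesSplit_of_properlySolvable {p : ℕ} (hp : p.Prime)
    (H : ∀ E : EmbeddingProblem G, E.IsFinite → E.IsPProblem p → E.ProperlySolvable) :
    TwoCocyclesSplit G p := by
  intro M _ _ _ _ _ _ z hz hzc ⟨a, ha⟩
  obtain ⟨b, hb, hbz, -⟩ := exists_cochain_of_properlySolvable hp H ha hz hzc
  refine ⟨fun g => -b g, hb.neg, fun g h => ?_⟩
  beta_reduce
  rw [hbz, smul_neg]
  abel

/-- The infimum defining `cd_p` is attained because `ℕ∞` is well-ordered; the defining set contains
`⊤`. -/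
theorem cohomologicalPDimension_le_one_iff (G : Type u) [Group G] [TopologicalSpace G]
    [IsTopologicalGroup G] (p : ℕ) : cohomologicalPDimension G p ≤ 1 ↔
    ∀ n : ℕ, ∀ A : TopRep.{u} ℤ G, IsDiscreteGModule A → IsAddTorsion A →
      ∀ x : continuousCohomology (n + 2) A, (∃ k : ℕ, p ^ k • x = 0) → x = 0 := by
  constructor
  · intro h n A hA ht
    have hmem := csInf_mem (s := {n : ℕ∞ | ∀ q : ℕ, n < (q : ℕ∞) → ∀ A : TopRep.{u} ℤ G,
      IsDiscreteGModule A → IsAddTorsion A →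
      ∀ x : continuousCohomology q A, (∃ k : ℕ, p ^ k • x = 0) → x = 0})
      ⟨⊤, fun q hq => absurd hq (not_lt_of_ge le_top)⟩
    refine hmem (n + 2) (lt_of_le_of_lt h ?_) A hA ht
    exact_mod_cast (by omega : 1 < n + 2)
  · intro h
    refine csInf_le' fun q hq => ?_
    have hq' : 1 < q := by exact_mod_cast hq
    obtain ⟨n, rfl⟩ : ∃ n, q = n + 2 := ⟨q - 2, by omega⟩
    exact h n

theorem isStronglyPDominating_of_properlySolvable {p : ℕ} (hp : p.Prime)
    (H : ∀ E : EmbeddingProblem G, E.IsFinite → E.IsPProblem p → E.ProperlySolvable) :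
    IsStronglyPDominating G p := by
  intro P hP _ _ hpP
  have := hP.discreteTopology
  by_contra hfin
  rw [not_infinite_iff_finite] at hfin
  obtain ⟨Ψ, -, hΨ⟩ := exists_oneCocycle_presentation P hP.continuous_action
  let _ : DistribMulAction G P :=
    { smul := fun g m => P.ρ g m
      one_smul := fun m => congrArg (fun f => f m) (map_one P.ρ)
      mul_smul := fun g h m => congrArg (fun f => f m) (map_mul P.ρ g h)
      smul_zero := fun g => map_zero (P.ρ g)
      smul_add := fun g m n => map_add (P.ρ g) m n }
  have hsmul : ∀ (g : G) (x : P), P.ρ g x = g • x := fun _ _ => rfl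
  have : ContinuousSMul G P := ⟨hP.continuous_action⟩
  let n := Nat.card (continuousCohomology 1 P) + 1
  obtain ⟨b, hb, hbc, hsurj⟩ := exists_cochain_of_properlySolvable hp H (M := Fin n → P) (a := 1)
    (fun m => funext fun i => by rw [pow_one]; exact hpP (m i)) (z := fun _ _ => 0)
    continuous_const (fun _ _ _ => by simp)
  have hbi : ∀ i, P.IsOneCocycle fun g => b g i := fun i =>
    ⟨(continuous_apply i).comp hb, fun g h => by
      beta_reduce
      rw [hbc]
      exact add_zero _⟩
  obtain ⟨i, j, hij, heq⟩ : ∃ i j, i ≠ j ∧ Ψ ⟨_, hbi i⟩ = Ψ ⟨_, hbi j⟩ := by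
    by_contra! hne
    have := Nat.card_le_card_of_injective (fun i => Ψ ⟨_, hbi i⟩)
      fun i j h => by_contra fun hij => hne i j hij h
    rw [Nat.card_fin] at this
    omega
  -- on an element acting trivially, a principal crossed homomorphism vanishes
  obtain ⟨a, ha⟩ := hΨ _ _ heq
  obtain ⟨y, hy⟩ := exists_ne (0 : P)
  obtain ⟨u, hu, hbu⟩ := hsurj (Pi.single i y)
  have hua : u • a = a := congrFun (hu fun _ => a) i
  have h1 : b u i - b u j = u • a - a := ha u
  rw [hua, hbu, Pi.single_eq_same, Pi.single_eq_of_ne hij.symm, sub_self, sub_zero] at h1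
  exact hy h1

end Lift

/-! ### From cohomology to proper solutions -/

section Converse

/-- The representation over `ℤ` given by an action on a discrete abelian group. -/
def TopRep.ofDiscrete {G : Type*} [Group G] {M : Type*} [AddCommGroup M] [TopologicalSpace M]
    [DiscreteTopology M] (φ : G →* AddMonoid.End M) : TopRep ℤ G :=
  TopRep.of (ContRepresentation.ofMonoidHom (R := ℤ) (V := M)
    { toFun := fun g => ⟨(φ g).toIntLinearMap, continuous_of_discreteTopology⟩
      map_one' := by rw [map_one]; rfl
      map_mul' := fun g h => by rw [map_mul]; rfl })

variable {G : Type u} [Group G] [TopologicalSpace G]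

/-- The representation given by an action on a multiplicative abelian group `N`. -/
def TopRep.ofMulAut {N : Type*} [CommGroup N] [TopologicalSpace (Additive N)]
    [DiscreteTopology (Additive N)] (ψ : G →* MulAut N) : TopRep ℤ G :=
  TopRep.ofDiscrete (M := Additive N)
    { toFun := fun g => MonoidHom.toAdditive (ψ g).toMonoidHom
      map_one' := by rw [map_one]; rfl
      map_mul' := fun g h => by rw [map_mul]; rfl }

theorem TopRep.ofMulAut_isDiscreteGModule {N : Type u} [CommGroup N] [TopologicalSpace (Additive N)]
    [hd : DiscreteTopology (Additive N)] (ψ : G →* MulAut N) (hψ : IsLocallyConstant ψ) :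
    IsDiscreteGModule (TopRep.ofMulAut ψ) := by
  refine ⟨hd, ?_⟩
  have h1 : IsLocallyConstant fun x : G × Additive N => (ψ x.1, x.2) :=
    (hψ.comp_continuous continuous_fst).prodMk
      (IsLocallyConstant.iff_continuous _ |>.2 continuous_snd)
  exact (h1.comp fun x : MulAut N × Additive N => Additive.ofMul (x.1 x.2.toMul)).continuous

variable [IsTopologicalGroup G]

/-- If `cd_p ≤ 1`, then `2`-cocycles with values in an abelian group of exponent `p` are
coboundaries. Local constancy stands for continuity with respect to the discrete topology. -/
theorem exists_of_twoCocycle_of_cohomologicalPDimension {p : ℕ} (hp : p.Prime)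
    (hcd : cohomologicalPDimension G p ≤ 1) {N : Type u} [CommGroup N]
    (hN : ∀ x : N, x ^ p = 1) (ψ : G →* MulAut N) (hψ : IsLocallyConstant ψ)
    (z : G → G → N) (hz : IsLocallyConstant fun q : G × G => z q.1 q.2)
    (hzc : ∀ g h k, ψ g (z h k) * z g (h * k) = z g h * z (g * h) k) :
    ∃ b : G → N, IsLocallyConstant b ∧ ∀ g h, z g h = ψ g (b h) * b g * (b (g * h))⁻¹ := by
  let _ : TopologicalSpace (Additive N) := ⊥
  have : DiscreteTopology (Additive N) := ⟨rfl⟩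
  have hA := ofMulAut_isDiscreteGModule ψ hψ
  have ht : IsAddTorsion (ofMulAut ψ) := fun x =>
    isOfFinAddOrder_iff_nsmul_eq_zero.2 ⟨p, hp.pos, hN x⟩
  obtain ⟨b, hb, hbz⟩ := exists_twoCochain_of_eq_zero (ofMulAut ψ) p hN
    (fun x hx => (cohomologicalPDimension_le_one_iff G p).1 hcd 0 _ hA ht x
      ⟨1, by rwa [pow_one]⟩)
    (fun g h => Additive.ofMul (z g h)) (hz.comp Additive.ofMul).continuous
    (fun g h k => (hzc g h k).trans (mul_comm _ _))
  refine ⟨fun g => Additive.toMul (α := N) (b g),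
    ((IsLocallyConstant.iff_continuous (Y := Additive N) _).2 hb).comp Additive.toMul,
    fun g h => ?_⟩
  refine (hbz g h).trans ?_
  change Additive.ofMul (ψ g (Additive.toMul (α := N) (b h)) / Additive.toMul (α := N) (b (g * h)) *
    Additive.toMul (α := N) (b g)) = Additive.ofMul _
  rw [div_mul_eq_mul_div, div_eq_mul_inv]
  rfl

theorem infinite_oneCocycle_of_isStronglyPDominating {p : ℕ}
    (hdom : IsStronglyPDominating G p) {N : Type u} [CommGroup N] [Finite N] [Nontrivial N]
    (hN : ∀ x : N, x ^ p = 1) (ψ : G →* MulAut N) (hψ : IsLocallyConstant ψ) :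
    Infinite {c : G → N // IsLocallyConstant c ∧ ∀ g h, c (g * h) = c g * ψ g (c h)} := by
  let _ : TopologicalSpace (Additive N) := ⊥
  have : DiscreteTopology (Additive N) := ⟨rfl⟩
  have hA := ofMulAut_isDiscreteGModule ψ hψ
  have := hdom (ofMulAut ψ) hA (inferInstanceAs (Finite (Additive N)))
    (inferInstanceAs (Nontrivial (Additive N))) hN
  obtain ⟨Ψ, hΨ, -⟩ := exists_oneCocycle_presentation (ofMulAut ψ) hA.continuous_action
  have := Infinite.of_surjective Ψ hΨ
  refine Infinite.of_injective (fun c : {c : G → ofMulAut ψ // (ofMulAut ψ).IsOneCocycle c} =>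
    ⟨fun g => Additive.toMul (α := N) (c.1 g),
    ((IsLocallyConstant.iff_continuous (Y := Additive N) _).2 c.2.1).comp Additive.toMul, c.2.2⟩) ?_
  intro c c' h
  have h1 := Subtype.ext_iff.1 h
  exact Subtype.ext h1

/-- A surjection onto `Γ ⧸ N`, with `N` a minimal normal subgroup of exponent `p`, lifts to `Γ`. -/
theorem exists_surjective_lift_of_minimal_normal {p : ℕ} (hp : p.Prime)
    (hcd : cohomologicalPDimension G p ≤ 1) (hdom : IsStronglyPDominating G p)
    {Γ : Type u} [Group Γ] [Finite Γ] (N : Subgroup Γ) [hNn : N.Normal] (hNbot : N ≠ ⊥)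
    (hNmin : ∀ L : Subgroup Γ, L.Normal → L ≤ N → L = ⊥ ∨ L = N)
    (hNcomm : ∀ x ∈ N, ∀ y ∈ N, x * y = y * x) (hNp : ∀ x ∈ N, x ^ p = 1)
    (α : G →* Γ ⧸ N) (hα : IsLocallyConstant α) (hαs : Function.Surjective α) :
    ∃ β : G →* Γ, IsLocallyConstant β ∧ Function.Surjective β ∧
      (QuotientGroup.mk' N).comp β = α := by
  let _ : CommGroup N := { (inferInstance : Group N) with
    mul_comm := fun x y => Subtype.ext (hNcomm x x.2 y y.2) }
  have : Nontrivial N := N.nontrivial_iff_ne_bot.2 hNbot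
  have hNp' : ∀ x : N, x ^ p = 1 := fun x => Subtype.ext (hNp x x.2)
  let c : Γ ⧸ N →* MulAut N := QuotientGroup.lift N MulAut.conjNormal fun x hx => by
    ext y
    rw [MulAut.conjNormal_apply, hNcomm x hx y y.2, mul_inv_cancel_right]
    rfl
  let ψ : G →* MulAut N := c.comp α
  have hψ : IsLocallyConstant ψ := hα.comp c
  have hψ_apply : ∀ g x, QuotientGroup.mk x = α g → ∀ n : N, (ψ g n : Γ) = x * n * x⁻¹ :=
    fun g x hx n => by
    change ((c (α g)) n : Γ) = _
    rw [← hx]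
    exact MulAut.conjNormal_apply x n
  have hmem : ∀ x y : Γ, (QuotientGroup.mk x : Γ ⧸ N) = QuotientGroup.mk y → x * y⁻¹ ∈ N :=
    fun x y h => by
    rw [← QuotientGroup.eq_one_iff, QuotientGroup.mk_mul, QuotientGroup.mk_inv, h, mul_inv_cancel]
  -- a weak solution exists
  obtain ⟨β, hβ, hβα⟩ : ∃ β : G →* Γ, IsLocallyConstant β ∧
      ∀ g, (QuotientGroup.mk (β g) : Γ ⧸ N) = α g := by
    let σ : G → Γ := fun g => (α g).out
    have hσ : ∀ g, (QuotientGroup.mk (σ g) : Γ ⧸ N) = α g := fun g => QuotientGroup.out_eq' _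
    have hσl : IsLocallyConstant σ := hα.comp _
    have hzN : ∀ g h, σ g * σ h * (σ (g * h))⁻¹ ∈ N := fun g h =>
      hmem _ _ (by rw [QuotientGroup.mk_mul, hσ, hσ, hσ, map_mul])
    obtain ⟨b, hb, hbz⟩ := exists_of_twoCocycle_of_cohomologicalPDimension hp hcd hNp' ψ hψ
      (fun g h => ⟨_, hzN g h⟩) (by
        have h1 : IsLocallyConstant fun q : G × G => ((σ q.1, σ q.2), σ (q.1 * q.2)) :=
          ((hσl.comp_continuous continuous_fst).prodMk (hσl.comp_continuous continuous_snd)).prodMk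
            (hσl.comp_continuous continuous_mul)
        refine IsLocallyConstant.desc _ Subtype.val ?_ Subtype.val_injective
        exact h1.comp fun t : (Γ × Γ) × Γ => t.1.1 * t.1.2 * t.2⁻¹)
      (fun g h k => Subtype.ext (by
        simp only [Subgroup.coe_mul, hψ_apply g _ (hσ g), mul_assoc]
        group))
    have hbz' : ∀ g h, σ g * σ h * (σ (g * h))⁻¹ =
        σ g * b h * (σ g)⁻¹ * b g * (b (g * h) : Γ)⁻¹ := fun g h => by
      have := congrArg Subtype.val (hbz g h)
      simpa only [Subgroup.coe_mul, Subgroup.coe_inv, hψ_apply g _ (hσ g)] using this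
    refine ⟨MonoidHom.mk' (fun g => (b g : Γ)⁻¹ * σ g) fun g h => ?_, ?_, fun g => ?_⟩
    · have h1 := eq_mul_of_mul_inv_eq (hbz' g h)
      have h2 : σ (g * h) = (σ g * b h * (σ g)⁻¹ * b g * (b (g * h) : Γ)⁻¹)⁻¹ * (σ g * σ h) := by
        rw [h1, inv_mul_cancel_left]
      rw [h2]
      group
    · exact (hb.prodMk hσl).comp fun t : N × Γ => (t.1 : Γ)⁻¹ * t.2
    · change (QuotientGroup.mk ((b g : Γ)⁻¹ * σ g) : Γ ⧸ N) = α g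
      rw [QuotientGroup.mk_mul, (QuotientGroup.eq_one_iff _).2 (inv_mem (b g).2), one_mul, hσ]
  -- crossed homomorphisms `c` parametrize the weak solutions `B c`
  have := infinite_oneCocycle_of_isStronglyPDominating hdom hNp' ψ hψ
  let Z := {c : G → N // IsLocallyConstant c ∧ ∀ g h, c (g * h) = c g * ψ g (c h)}
  let B : Z → G →* Γ := fun c => MonoidHom.mk' (fun g => c.1 g * β g) fun g h => by
    rw [c.2.2, map_mul, Subgroup.coe_mul, hψ_apply g _ (hβα g)]
    group
  have hB : ∀ c g, B c g = c.1 g * β g := fun _ _ => rfl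
  have hBα : ∀ c g, (QuotientGroup.mk (B c g) : Γ ⧸ N) = α g := fun c g => by
    rw [hB, QuotientGroup.mk_mul, (QuotientGroup.eq_one_iff _).2 (c.1 g).2, one_mul, hβα]
  by_contra hno
  have hBs : ∀ c, ¬ Function.Surjective (B c) := fun c hs => hno ⟨B c,
    (c.2.1.prodMk hβ).comp fun t : N × Γ => (t.1 : Γ) * t.2, hs, MonoidHom.ext (hBα c)⟩
  -- an image that is not all of `Γ` is a complement of `N`
  have hBN : ∀ c, (B c).range ⊓ N = ⊥ := fun c => by
    have hdec : ∀ γ : Γ, ∃ n ∈ N, ∃ g, γ = n * B c g := fun γ => by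
      obtain ⟨g, hg⟩ := hαs (QuotientGroup.mk γ)
      exact ⟨_, hmem γ (B c g) ((hBα c g).trans hg).symm, g, by group⟩
    have hnormal : ((B c).range ⊓ N).Normal := ⟨fun x hx γ => by
      refine ⟨?_, hNn.conj_mem x hx.2 γ⟩
      obtain ⟨n, hn, g, rfl⟩ := hdec γ
      have h1 : B c g * x * (B c g)⁻¹ ∈ N := hNn.conj_mem x hx.2 _
      have h2 : n * B c g * x * (n * B c g)⁻¹ = B c g * x * (B c g)⁻¹ := by
        rw [mul_inv_rev, ← mul_inv_cancel_right (B c g * x * (B c g)⁻¹) n, ← hNcomm n hn _ h1]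
        group
      have hg : B c g ∈ (B c).range := ⟨g, rfl⟩
      rw [h2]
      exact mul_mem (mul_mem hg hx.1) ((B c).range.inv_mem hg)⟩
    refine (hNmin _ hnormal inf_le_right).resolve_right fun h => hBs c fun γ => ?_
    obtain ⟨n, hn, g, rfl⟩ := hdec γ
    rw [← h] at hn
    exact mul_mem hn.1 ⟨g, rfl⟩
  -- two weak solutions with the same image agree, as they differ by elements of `N`
  obtain ⟨c₁, c₂, hne, heq⟩ := Finite.exists_ne_map_eq_of_infinite fun c => (B c).range
  refine hne (Subtype.ext (funext fun g => Subtype.ext ?_))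
  have h1 : (c₁.1 g : Γ) * (c₂.1 g : Γ)⁻¹ = B c₁ g * (B c₂ g)⁻¹ := by
    rw [hB, hB]
    group
  have h2 : (c₁.1 g : Γ) * (c₂.1 g : Γ)⁻¹ ∈ (B c₁).range ⊓ N := by
    refine ⟨?_, mul_mem (c₁.1 g).2 (N.inv_mem (c₂.1 g).2)⟩
    rw [h1]
    have hg : B c₂ g ∈ (B c₁).range := heq ▸ ⟨g, rfl⟩
    exact mul_mem ⟨g, rfl⟩ ((B c₁).range.inv_mem hg)
  rw [hBN, Subgroup.mem_bot, mul_inv_eq_one] at h2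
  exact h2

/-- A nontrivial normal `p`-subgroup contains a minimal normal subgroup, and this is elementary
abelian: its center and its subgroup of elements of exponent `p` are normal and nontrivial. -/
theorem IsPGroup.exists_minimal_normal {p : ℕ} (hp : p.Prime) {Γ : Type*} [Group Γ] [Finite Γ]
    (K : Subgroup Γ) [K.Normal] (hK : IsPGroup p K) (hKbot : K ≠ ⊥) :
    ∃ N : Subgroup Γ, N.Normal ∧ N ≤ K ∧ N ≠ ⊥ ∧
      (∀ L : Subgroup Γ, L.Normal → L ≤ N → L = ⊥ ∨ L = N) ∧
      (∀ x ∈ N, ∀ y ∈ N, x * y = y * x) ∧ ∀ x ∈ N, x ^ p = 1 := by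
  have : Fact p.Prime := ⟨hp⟩
  obtain ⟨N, ⟨hN, hNK, hNbot⟩, hmin⟩ := (Set.toFinite
    {L : Subgroup Γ | L.Normal ∧ L ≤ K ∧ L ≠ ⊥}).exists_minimal ⟨K, ‹_›, le_rfl, hKbot⟩
  have hNmin : ∀ L : Subgroup Γ, L.Normal → L ≤ N → L = ⊥ ∨ L = N := fun L hL hLN =>
    or_iff_not_imp_left.2 fun h => le_antisymm hLN (hmin ⟨hL, hLN.trans hNK, h⟩ hLN)
  have hNp : IsPGroup p N := hK.to_le hNK
  have : Nontrivial N := N.nontrivial_iff_ne_bot.2 hNbot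
  have hcomm : ∀ x ∈ N, ∀ y ∈ N, x * y = y * x := by
    have := hNp.center_nontrivial
    have h1 := (hNmin ((Subgroup.center N).map N.subtype) inferInstance
      (Subgroup.map_subtype_le _)).resolve_left fun h =>
        (Subgroup.nontrivial_iff_ne_bot _).1 this
          ((Subgroup.map_eq_bot_iff_of_injective _ N.subtype_injective).1 h)
    intro x hx y hy
    rw [← h1] at hx
    obtain ⟨x, hx, rfl⟩ := hx
    exact (congrArg Subtype.val (Subgroup.mem_center_iff.1 hx ⟨y, hy⟩)).symm
  refine ⟨N, hN, hNK, hNbot, hNmin, hcomm, ?_⟩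
  let L : Subgroup Γ :=
    { carrier := {x | x ∈ N ∧ x ^ p = 1}
      one_mem' := ⟨one_mem _, one_pow _⟩
      mul_mem' := fun {x y} hx hy => ⟨mul_mem hx.1 hy.1, by
        rw [(show Commute x y from hcomm x hx.1 y hy.1).mul_pow, hx.2, hy.2, one_mul]⟩
      inv_mem' := fun {x} hx => ⟨inv_mem hx.1, by rw [inv_pow, hx.2, inv_one]⟩ }
  have hL : L.Normal := ⟨fun x hx g => ⟨hN.conj_mem x hx.1 g, by
    rw [conj_pow, hx.2, mul_one, mul_inv_cancel]⟩⟩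
  have hLbot : L ≠ ⊥ := by
    obtain ⟨n, hn⟩ := IsPGroup.iff_card.1 hNp
    have hdvd : p ∣ Nat.card N := by
      rw [hn]
      refine dvd_pow_self p ?_
      rintro rfl
      exact (Finite.one_lt_card (α := N)).ne' (by rw [hn, pow_zero])
    obtain ⟨x, hx⟩ := exists_prime_orderOf_dvd_card' p hdvd
    intro h
    have hxL : (x : Γ) ∈ L := ⟨x.2, by
      rw [← hx]
      exact congrArg Subtype.val (pow_orderOf_eq_one x)⟩
    rw [h, Subgroup.mem_bot] at hxL
    have : x = 1 := Subtype.ext hxL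
    rw [this, orderOf_one] at hx
    exact hp.one_lt.ne hx
  have hLN := (hNmin L hL fun x hx => hx.1).resolve_left hLbot
  intro x hx
  rw [← hLN] at hx
  exact hx.2

theorem exists_surjective_lift {p : ℕ} (hp : p.Prime)
    (hcd : cohomologicalPDimension G p ≤ 1) (hdom : IsStronglyPDominating G p)
    {Q : Type u} [Group Q]
    (α : G →* Q) (hα : IsLocallyConstant α) (hαs : Function.Surjective α) (n : ℕ) :
    ∀ (Γ : Type u) [Group Γ] [Finite Γ] (f : Γ →* Q), Function.Surjective f →
      IsPGroup p f.ker → Nat.card Γ = n →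
      ∃ β : G →* Γ, IsLocallyConstant β ∧ Function.Surjective β ∧ f.comp β = α := by
  induction n using Nat.strong_induction_on with
  | _ n ih =>
  intro Γ _ _ f hf hker hn
  by_cases hbot : f.ker = ⊥
  · let e := MulEquiv.ofBijective f ⟨(MonoidHom.ker_eq_bot_iff f).1 hbot, hf⟩
    exact ⟨e.symm.toMonoidHom.comp α, hα.comp e.symm, e.symm.surjective.comp hαs,
      MonoidHom.ext fun g => e.apply_symm_apply (α g)⟩
  · obtain ⟨N, hNn, hNK, hNbot, hNmin, hNcomm, hNp⟩ := hker.exists_minimal_normal hp f.ker hbot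
    let f' : Γ ⧸ N →* Q := QuotientGroup.lift N f hNK
    have hcard : Nat.card (Γ ⧸ N) < n := by
      have : Nontrivial N := N.nontrivial_iff_ne_bot.2 hNbot
      rw [← hn, N.card_eq_card_quotient_mul_card_subgroup]
      exact lt_mul_of_one_lt_right Nat.card_pos Finite.one_lt_card
    obtain ⟨γ, hγ, hγs, hγα⟩ := ih _ hcard (Γ ⧸ N) f'
      (fun q => let ⟨x, hx⟩ := hf q; ⟨QuotientGroup.mk x, hx⟩)
      (by
        rintro ⟨q, hq⟩
        obtain ⟨x, rfl⟩ := QuotientGroup.mk_surjective q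
        obtain ⟨k, hk⟩ := hker ⟨x, hq⟩
        exact ⟨k, Subtype.ext (congrArg QuotientGroup.mk (congrArg Subtype.val hk))⟩) rfl
    obtain ⟨β, hβ, hβs, hβγ⟩ := exists_surjective_lift_of_minimal_normal hp hcd hdom N hNbot hNmin
      hNcomm hNp γ hγ hγs
    exact ⟨β, hβ, hβs, by rw [← hγα, ← hβγ]; rfl⟩

end Converse

theorem theorem4p2 (p : ℕ) (hp : p.Prime) (G : Type u) [Group G] [TopologicalSpace G]
    [IsTopologicalGroup G] [CompactSpace G] [TotallyDisconnectedSpace G] :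
    (∀ E : EmbeddingProblem G, E.IsFinite → E.IsPProblem p → E.ProperlySolvable) ↔
      cohomologicalPDimension G p ≤ 1 ∧ IsStronglyPDominating G p := by
  constructor
  · intro H
    refine ⟨(cohomologicalPDimension_le_one_iff G p).2 fun n A hA ht x ⟨a, hx⟩ => ?_,
      isStronglyPDominating_of_properlySolvable hp H⟩
    exact (twoCocyclesSplit_of_properlySolvable hp H).eq_zero_of_pow_smul_eq_zero hp A
      hA.discreteTopology hA.continuous_action ht n a x hx
  · rintro ⟨hcd, hdom⟩ E hE hEp
    have : Finite E.B := hE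
    have : Finite E.A := Finite.of_surjective _ E.f_surjective
    obtain ⟨β, hβ, hβs, hβα⟩ := exists_surjective_lift hp hcd hdom E.α.toMonoidHom
      ((IsLocallyConstant.iff_continuous _).2 E.α.continuous_toFun) E.α_surjective _ E.B
      E.f.toMonoidHom E.f_surjective hEp rfl
    exact ⟨⟨β, hβ.continuous⟩, ContinuousMonoidHom.ext fun g => DFunLike.congr_fun hβα g, hβs⟩
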